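/- Let $\mathcal H$ be a finite-dimensional complex Hilbert space, and let $A=\sum_a a\,\Pi^A_a$, $F=\sum_f f\,\Pi^F_f$ and $\mathcal I=\sum_i\lambda_i\,\Pi^{\mathcal I}_i$ be the eigenvalue decompositions of observables (Hermitian operators with orthogonal eigenprojectors $\Pi$). A weak measurement of $A$ with finitely many outcomes $j$ is a family of Kraus operators $K_j=K_j(\tilde g)$, depending on a real coupling parameter $\tilde g$ near $0$, with $\sum_j K_j^\dagger K_j=\mathbb 1$ and $$K_j=\sqrt{p_j}\,\mathbb 1+g_j A+O(\tilde g^2),$$ where $p_j\ge 0$ does not depend on $\tilde g$, and the couplings $g_j=g_j(\tilde g)\in\mathbb C$ satisfy $g_j=O(\tilde g)$. POVM I is this weak measurement followed by a strong measurement of $F$, with Kraus operators $\Pi^F_f K_j$. POVM II is the strong measurement of $\mathcal I$, with Kraus operators $\Pi^{\mathcal I}_i$. For a state $\rho$ (a density operator on $\mathcal H$) let $H_\alpha(AF)_\rho$ and $H_\alpha(\mathcal I)_\rho$ be the Rényi entropies of order $\alpha$ of the register states $\sum_{j,f}\mathrm{Tr}(\Pi^F_fK_j\rho K_j^\dagger\Pi^F_f)\,|j\rangle\langle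 j|\otimes|f\rangle\langle f|$ and $\sum_i\mathrm{Tr}(\Pi^{\mathcal I}_i\rho\,\Pi^{\mathcal I}_i)\,|i\rangle\langle i|$. Here $H_\alpha(\sigma)=\frac1{1-\alpha}\log\mathrm{Tr}(\sigma^\alpha)$, $H_1=H_{\mathrm{vN}}$ is the von Neumann entropy $-\mathrm{Tr}(\sigma\log\sigma)$, $H_\infty(\sigma)=-\log p_{\max}$ with $p_{\max}$ the largest eigenvalue of $\sigma$, and $\log$ is to base $2$. Put $$A_{\rm weak}(i,f)=\frac{\mathrm{Tr}(\Pi^F_f A\,\Pi^{\mathcal I}_i)}{\mathrm{Tr}(\Pi^F_f\Pi^{\mathcal I}_i)\,\mathrm{Tr}(\Pi^{\mathcal I}_i)}.$$ Theorem. There is a bound of the form $$f_{\rm weak}=\min_{i,j,f}\Big\{-\log\big(p_j\,\mathrm{Tr}(\Pi^F_f\Pi^{\mathcal I}_i)\big)-\frac{2}{\ln 2}\,\frac{\mathrm{Tr}(\Pi^{\mathcal I}_i)}{\sqrt{p_j}}\,\mathrm{Re}\big(g_jA_{\rm weak}(i,f)\big)+O(\tilde g^2)\Big\},$$ in which triples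 with $p_j\,\mathrm{Tr}(\Pi^F_f\Pi^{\mathcal I}_i)=0$ count as $+\infty$ and the $O(\tilde g^2)$ terms do not depend on $\rho$ or on the Rényi orders, such that, for all $\tilde g$ sufficiently close to $0$ and every state $\rho$, $$H_{\rm vN}(\mathcal I)_\rho+H_{\rm vN}(AF)_\rho\ge f_{\rm weak},$$ $$H_\alpha(\mathcal I)_\rho+H_\beta(AF)_\rho\ge f_{\rm weak}\quad\text{for all }\alpha,\beta\in[\tfrac12,\infty]\text{ with }\tfrac1\alpha+\tfrac1\beta=2.$$ -/

import Mathlib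

open Filter Topology Asymptotics
open scoped Matrix ENNReal ComplexOrder

noncomputable section

/-! Operators on the Hilbert space `ℂⁿ`, with `n` a finite index type, are matrices. -/

/-- Density operators: positive semidefinite operators of trace one. -/
def IsDensity {n : Type*} [Fintype n] (ρ : Matrix n n ℂ) : Prop :=
  ρ.PosSemidef ∧ ρ.trace = 1

/-- The eigenvalue decomposition `X = ∑ i, x i • Π i` of an observable `X`: the `x i` are the
distinct eigenvalues, and the `Π i` are the orthogonal projectors onto the eigenspaces. -/
structure EigenDecomposition {n : Type*} [Fintype n] [DecidableEq n]
    (X : Matrix n n ℂ) (ι : Type*) [Fintype ι] where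
  /-- the eigenvalues -/
  value : ι → ℝ
  /-- the eigenprojectors -/
  proj : ι → Matrix n n ℂ
  value_injective : Function.Injective value
  proj_ne_zero : ∀ i, proj i ≠ 0
  proj_isHermitian : ∀ i, (proj i).IsHermitian
  proj_mul_self : ∀ i, proj i * proj i = proj i
  proj_mul_of_ne : ∀ i k, i ≠ k → proj i * proj k = 0
  sum_proj : ∑ i, proj i = 1
  eq_sum : X = ∑ i, (value i : ℂ) • proj i

/-- The completeness relation `∑ x, (K x)† K x = 1` for Kraus operators. -/
def KrausComplete {n ι : Type*} [Fintype n] [DecidableEq n] [Fintype ι]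
    (K : ι → Matrix n n ℂ) : Prop :=
  ∑ x, (K x)ᴴ * K x = 1

/-- The state `∑ x, Tr (K x ρ (K x)†) |x⟩⟨x|` of the classical register in which the outcome `x`
of the measurement with Kraus operators `K`, made in the state `ρ`, is recorded.
For a pair `x = (j, f)`, `|x⟩⟨x|` is `|j⟩⟨j| ⊗ |f⟩⟨f|`. -/
def registerState {n ι : Type*} [Fintype n] [DecidableEq ι]
    (K : ι → Matrix n n ℂ) (ρ : Matrix n n ℂ) : Matrix ι ι ℂ :=
  Matrix.diagonal fun x => (K x * ρ * (K x)ᴴ).trace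

open Classical in
/-- The eigenvalues of a Hermitian matrix, with multiplicity (and `0` for other matrices). -/
def spectralValues {ι : Type*} [Fintype ι] [DecidableEq ι] (σ : Matrix ι ι ℂ) : ι → ℝ :=
  if h : σ.IsHermitian then h.eigenvalues else 0

/-- The von Neumann entropy `- Tr (σ log₂ σ)`. -/
def vonNeumannEntropy {ι : Type*} [Fintype ι] [DecidableEq ι] (σ : Matrix ι ι ℂ) : ℝ :=
  -∑ k, spectralValues σ k * Real.logb 2 (spectralValues σ k)

/-- The Rényi entropy of order `α ∈ (0, ∞]`: `(1 - α)⁻¹ log₂ (Tr σ^α)` for `α ≠ 1, ∞`,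
and the limits of this expression, the von Neumann entropy and the min-entropy
`- log₂ p_max`, for `α = 1` and `α = ∞`. -/
def renyiEntropy {ι : Type*} [Fintype ι] [DecidableEq ι] (α : ℝ≥0∞) (σ : Matrix ι ι ℂ) : ℝ :=
  if α = 1 then vonNeumannEntropy σ
  else if α = ∞ then -Real.logb 2 (⨆ k, spectralValues σ k)
  else 1 / (1 - α.toReal) * Real.logb 2 (∑ k, spectralValues σ k ^ α.toReal)

/-- `K j t`, for outcomes `j` of the detector and values `t` of the coupling parameter near `0`,
are Kraus operators of a weak measurement of `A`:
`K j = √(p j) 1 + g j A + O(t²)`, where `p j` is the probability of `j` without coupling and the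
outcome-dependent coupling `g j` is of first order in `t`. -/
structure IsWeakMeasurement {n J : Type*} [Fintype n] [DecidableEq n] [Fintype J]
    (A : Matrix n n ℂ) (p : J → ℝ) (g : J → ℝ → ℂ) (K : J → ℝ → Matrix n n ℂ) : Prop where
  prob_nonneg : ∀ j, 0 ≤ p j
  complete : ∀ᶠ t in 𝓝 (0 : ℝ), KrausComplete fun j => K j t
  coupling : ∀ j, g j =O[𝓝 0] fun t : ℝ => t
  expansion : ∀ j a b,
    (fun t : ℝ => (K j t - ((Real.sqrt (p j) : ℂ) • (1 : Matrix n n ℂ) + g j t • A)) a b)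
      =O[𝓝 0] fun t : ℝ => t ^ 2

/-- POVM I, a weak measurement (Kraus operators `K j`) followed by a strong measurement
(projectors `PF f`): the Kraus operators `PF f * K j`. -/
def krausI {n J φ : Type*} [Fintype n] (PF : φ → Matrix n n ℂ) (K : J → Matrix n n ℂ) :
    J × φ → Matrix n n ℂ :=
  fun x => PF x.2 * K x.1

/-- POVM II, a strong measurement: the Kraus operators are the projectors `PI i`. -/
def krausII {n ι : Type*} (PI : ι → Matrix n n ℂ) : ι → Matrix n n ℂ :=
  fun i => PI i

/-- The weak value `Tr (Π_f A Π_i) / (Tr (Π_f Π_i) Tr Π_i)`. -/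
def weakValue {n : Type*} [Fintype n] (A Pi Pf : Matrix n n ℂ) : ℂ :=
  (Pf * A * Pi).trace / ((Pf * Pi).trace * Pi.trace)

/-- The expression under the minimum in the bound, up to first order, for an outcome with
coupling-free probability `p`, coupling `g`, and projectors `Pi`, `Pf`. -/
def weakBoundTerm {n : Type*} [Fintype n] (A Pi Pf : Matrix n n ℂ) (p : ℝ) (g : ℂ) : ℝ :=
  -Real.logb 2 (p * (Pf * Pi).trace.re)
    - 2 / Real.log 2 * (Pi.trace.re / Real.sqrt p) * (g * weakValue A Pi Pf).re

/-- The bound `f_weak`: the minimum over `i, j, f` of the terms above plus second-order terms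
`R i j f`. Since `- log 0 = + ∞`, the triples with `p j * Tr (Π_f Π_i) = 0` do not contribute
to the minimum. -/
def fWeak {n J ι φ : Type*} [Fintype n] (A : Matrix n n ℂ)
    (PI : ι → Matrix n n ℂ) (PF : φ → Matrix n n ℂ) (p : J → ℝ) (g : J → ℂ)
    (R : ι → J → φ → ℝ) : ℝ :=
  ⨅ x : {x : ι × J × φ // p x.2.1 * (PF x.2.2 * PI x.1).trace.re ≠ 0},
    (weakBoundTerm A (PI x.1.1) (PF x.1.2.2) (p x.1.2.1) (g x.1.2.1)
      + R x.1.1 x.1.2.1 x.1.2.2)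

end

/-! The theorem is a Maassen–Uffink relation whose constant is expanded to first order in the
coupling. For Kraus families `X` and `Y`, let `c` bound every squared Frobenius norm of `X x * (Y
y)ᴴ`. Then conjugate Rényi entropies sum to at least `-log c`. For POVMs II and I these norms are
the overlaps `Tr (Π_f K_j Π_i K_j†)`. The relation comes from a dual inequality (`DualBound`): for
probability weights `u`, `v` and `0 < s ≤ 1`, `∑ u^s P ≤ c^s ∑ v^(-s) Q`, provided `v` vanishes only
where `Q` does. The three-lines theorem proves it for vectors (`sum_rpow_mul_norm_sq_le`), and
linearity extends it to states. Optimal weights give the Rényi bounds, and the derivative at `s = 0`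
gives the Shannon bound. By `isBigO_overlap_sub` the overlap is `p Tr (Π_f Π_i) + 2 √p Re (g Tr (Π_f
A Π_i)) + O(t²)`, and minus its logarithm is the weak-value expression. Triples with vanishing
zeroth-order term have overlaps tending to `0`, so near `t = 0` they do not affect the maximum. -/

/-! ### Complex interpolation and the dual inequality for vectors -/

open Complex.HadamardThreeLines in
/-- Three-lines interpolation for a finite bilinear form with weights `u`, `v`: a bound which is
uniform in the phases at exponent `0`, and a bound at exponent `1`, interpolate. -/
theorem norm_sum_rpow_mul_le_interp {ι κ : Type*} [Fintype ι] [Fintype κ]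
    {m : ι → κ → ℂ} {u : ι → ℝ} {v : κ → ℝ} (hu : ∀ x, 0 ≤ u x) (hv : ∀ y, 0 ≤ v y)
    (hmu : ∀ x y, u x = 0 → m x y = 0) (hmv : ∀ x y, v y = 0 → m x y = 0) {N M : ℝ}
    (h0 : ∀ (ε : ι → ℂ) (δ : κ → ℂ), (∀ x, ‖ε x‖ = 1) → (∀ y, ‖δ y‖ = 1) →
      ‖∑ x, ∑ y, ε x * δ y * m x y‖ ≤ N)
    (h1 : ∑ x, ∑ y, Real.sqrt (u x) * Real.sqrt (v y) * ‖m x y‖ ≤ M)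
    {s : ℝ} (hs0 : 0 ≤ s) (hs1 : s ≤ 1) :
    ‖∑ x, ∑ y, ((u x ^ (s / 2) * v y ^ (s / 2) : ℝ) : ℂ) * m x y‖ ≤ N ^ (1 - s) * M ^ s := by
  have hre : ∀ (r : ℝ) (z : ℂ), ‖Complex.exp (z / 2 * (Real.log r : ℂ))‖
      = Real.exp (z.re / 2 * Real.log r) := by
    intro r z
    rw [Complex.norm_exp]
    congr 1
    rw [Complex.re_mul_ofReal]
    congr 1
    simp
  have hexp : ∀ (r t : ℝ), 0 < r → Real.exp (t / 2 * Real.log r) = r ^ (t / 2) := by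
    intro r t hr
    rw [Real.rpow_def_of_pos hr, mul_comm]
  -- The weights `u^(z/2)` and `v^(z/2)` are written as exponentials to be entire. A zero weight
  -- yields the factor `1`, since `Real.log 0 = 0`; this is harmless because `m` vanishes there.
  let f : ℂ → ℂ := fun z => ∑ x, ∑ y,
    Complex.exp (z / 2 * (Real.log (u x) : ℂ)) * Complex.exp (z / 2 * (Real.log (v y) : ℂ)) * m x y
  have hf : Differentiable ℂ f := by
    unfold f
    fun_prop
  have hbound : BddAbove ((norm ∘ f) '' verticalClosedStrip 0 1) := by
    refine ⟨∑ x, ∑ y, Real.exp |Real.log (u x)| * Real.exp |Real.log (v y)| * ‖m x y‖, ?_⟩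
    rintro _ ⟨z, hz, rfl⟩
    simp only [verticalClosedStrip, Set.mem_preimage, Set.mem_Icc] at hz
    have hle : ∀ r : ℝ, z.re / 2 * Real.log r ≤ |Real.log r| := by
      intro r
      calc z.re / 2 * Real.log r ≤ |z.re / 2 * Real.log r| := le_abs_self _
        _ = z.re / 2 * |Real.log r| := by rw [abs_mul, abs_of_nonneg (by linarith [hz.1])]
        _ ≤ 1 * |Real.log r| := by gcongr; linarith [hz.2]
        _ = _ := one_mul _
    refine (norm_sum_le _ _).trans (Finset.sum_le_sum fun x _ => (norm_sum_le _ _).trans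
      (Finset.sum_le_sum fun y _ => ?_))
    rw [norm_mul, norm_mul, hre, hre]
    gcongr
    · exact hle _
    · exact hle _
  have key := norm_le_interp_of_mem_verticalClosedStrip₀₁' f (z := (s : ℂ)) (a := N) (b := M)
    (by simp [verticalClosedStrip, hs0, hs1]) hf.diffContOnCl hbound
    (by
      intro z hz
      have hz' : z.re = 0 := hz
      exact h0 _ _ (fun x => by rw [hre, hz']; simp) (fun y => by rw [hre, hz']; simp))
    (by
      intro z hz
      have hz' : z.re = 1 := hz
      refine le_trans ((norm_sum_le _ _).trans (Finset.sum_le_sum fun x _ => (norm_sum_le _ _).trans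
        (Finset.sum_le_sum fun y _ => ?_))) h1
      rw [norm_mul, norm_mul, hre, hre, hz']
      rcases (hu x).eq_or_lt with hx | hx
      · simp [hmu x y hx.symm]
      rcases (hv y).eq_or_lt with hy | hy
      · simp [hmv x y hy.symm]
      rw [hexp _ _ hx, hexp _ _ hy, Real.sqrt_eq_rpow, Real.sqrt_eq_rpow])
  rw [Complex.ofReal_re] at key
  refine le_of_eq_of_le (congrArg norm ?_) key
  refine Finset.sum_congr rfl fun x _ => Finset.sum_congr rfl fun y _ => ?_
  rcases (hu x).eq_or_lt with hx | hx
  · simp [hmu x y hx.symm]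
  rcases (hv y).eq_or_lt with hy | hy
  · simp [hmv x y hy.symm]
  rw [← hexp _ _ hx, ← hexp _ _ hy]
  push_cast
  rfl

theorem sum_norm_sq_eq_of_sum_adjoint_apply {E κ : Type*} [NormedAddCommGroup E]
    [InnerProductSpace ℂ E] [CompleteSpace E] [Fintype κ] {Y : κ → E →L[ℂ] E}
    (hY : ∀ w, ∑ y, (Y y).adjoint (Y y w) = w) (w : E) : ∑ y, ‖Y y w‖ ^ 2 = ‖w‖ ^ 2 := by
  have h : inner ℂ w (∑ y, (Y y).adjoint (Y y w)) = inner ℂ w w := by rw [hY]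
  rw [inner_sum] at h
  simp only [ContinuousLinearMap.adjoint_inner_right, inner_self_eq_norm_sq_to_K] at h
  exact_mod_cast h

/-- The interpolated Landau–Pollak type inequality for two families of Kraus operators on a Hilbert
space, with `c` bounding the squared norms of the products `X x ∘ (Y y)†`. -/
theorem sum_rpow_mul_norm_sq_le {E ι κ : Type*} [NormedAddCommGroup E] [InnerProductSpace ℂ E]
    [CompleteSpace E] [Fintype ι] [Fintype κ] {X : ι → E →L[ℂ] E} {Y : κ → E →L[ℂ] E}
    (hX : ∀ w, ∑ x, (X x).adjoint (X x w) = w)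
    (hY : ∀ w, ∑ y, (Y y).adjoint (Y y w) = w) {c : ℝ} (hc : 0 ≤ c)
    (hXY : ∀ x y w, ‖X x ((Y y).adjoint w)‖ ≤ Real.sqrt c * ‖w‖)
    {u : ι → ℝ} {v : κ → ℝ} (hu : ∀ x, 0 ≤ u x) (hv : ∀ y, 0 ≤ v y)
    (hu1 : ∑ x, u x = 1) (hv1 : ∑ y, v y = 1) (ψ : E) (hvψ : ∀ y, v y = 0 → Y y ψ = 0)
    {s : ℝ} (hs0 : 0 < s) (hs1 : s ≤ 1) :
    ∑ x, u x ^ s * ‖X x ψ‖ ^ 2 ≤ c ^ s * ∑ y, v y ^ (-s) * ‖Y y ψ‖ ^ 2 := by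
  have hXn := sum_norm_sq_eq_of_sum_adjoint_apply hX
  have hYn := sum_norm_sq_eq_of_sum_adjoint_apply hY
  have hs2 : s / 2 ≠ 0 := by positivity
  -- The exponents are chosen so that at `z = s` the interpolated form equals `∑ ‖a x‖²`: `v^(s/2)`
  -- cancels the weight in `b`, and `u^(s/2)` rebuilds `a`.
  let a : ι → E := fun x => ((u x ^ (s / 2) : ℝ) : ℂ) • X x ψ
  let b : κ → E := fun y => ((v y ^ (-(s / 2)) : ℝ) : ℂ) • Y y ψ
  have hpow : ∀ r : ℝ, 0 ≤ r → ∀ t : ℝ, (r ^ (t / 2)) ^ 2 = r ^ t := by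
    intro r hr t
    rw [← Real.rpow_natCast, ← Real.rpow_mul hr]
    congr 1
    push_cast
    ring
  have ha : ∀ x, ‖a x‖ ^ 2 = u x ^ s * ‖X x ψ‖ ^ 2 := by
    intro x
    simp only [a]
    rw [norm_smul, mul_pow, Complex.norm_real, Real.norm_eq_abs, sq_abs, hpow _ (hu x)]
  have hb : ∀ y, ‖b y‖ ^ 2 = v y ^ (-s) * ‖Y y ψ‖ ^ 2 := by
    intro y
    simp only [b]
    rw [norm_smul, mul_pow, Complex.norm_real, Real.norm_eq_abs, sq_abs, ← neg_div,
      hpow _ (hv y)]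
  have ha0 : ∀ x, u x = 0 → a x = 0 := by
    intro x hx
    simp [a, hx, Real.zero_rpow hs2]
  have hb0 : ∀ y, v y = 0 → b y = 0 := by
    intro y hy
    simp [b, hvψ y hy]
  set A := ∑ x, ‖a x‖ ^ 2 with hA
  set B := ∑ y, ‖b y‖ ^ 2 with hB
  have hA0 : 0 ≤ A := Finset.sum_nonneg fun _ _ => by positivity
  have hB0 : 0 ≤ B := Finset.sum_nonneg fun _ _ => by positivity
  suffices h : A ≤ c ^ s * B by
    simpa only [hA, hB, ha, hb] using h
  let m : ι → κ → ℂ := fun x y => inner ℂ (a x) (X x ((Y y).adjoint (b y)))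
  have hphase : ∀ (ε : ι → ℂ) (δ : κ → ℂ), (∀ x, ‖ε x‖ = 1) → (∀ y, ‖δ y‖ = 1) →
      ‖∑ x, ∑ y, ε x * δ y * m x y‖ ≤ Real.sqrt A * Real.sqrt B := by
    intro ε δ hε hδ
    set w : E := ∑ y, (Y y).adjoint (δ y • b y) with hw
    have hsum : ∑ x, ∑ y, ε x * δ y * m x y = ∑ x, ε x * inner ℂ (a x) (X x w) := by
      refine Finset.sum_congr rfl fun x _ => ?_
      rw [hw, map_sum, inner_sum, Finset.mul_sum]
      refine Finset.sum_congr rfl fun y _ => ?_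
      simp only [m, map_smul, inner_smul_right]
      ring
    -- By completeness `w ↦ (Y y w)_y` is an isometry, so its adjoint is a contraction.
    have hwB : ‖w‖ ≤ Real.sqrt B := by
      have h1 : ‖w‖ ^ 2 ≤ ‖w‖ * Real.sqrt B := by
        calc ‖w‖ ^ 2 = ‖inner ℂ w w‖ := by
              rw [inner_self_eq_norm_sq_to_K]; simp
          _ = ‖∑ y, inner ℂ (Y y w) (δ y • b y)‖ := by
              conv_lhs => rw [hw, inner_sum]
              simp only [ContinuousLinearMap.adjoint_inner_right, ← hw]
          _ ≤ ∑ y, ‖Y y w‖ * ‖b y‖ := by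
              refine (norm_sum_le _ _).trans (Finset.sum_le_sum fun y _ => ?_)
              refine (norm_inner_le_norm _ _).trans ?_
              rw [norm_smul, hδ, one_mul]
          _ ≤ Real.sqrt (∑ y, ‖Y y w‖ ^ 2) * Real.sqrt (∑ y, ‖b y‖ ^ 2) :=
              Real.sum_mul_le_sqrt_mul_sqrt _ _ _
          _ = ‖w‖ * Real.sqrt B := by rw [hYn, Real.sqrt_sq (norm_nonneg _)]
      rcases (norm_nonneg w).eq_or_lt with h | h
      · rw [← h]; positivity
      · nlinarith
    rw [hsum]
    calc ‖∑ x, ε x * inner ℂ (a x) (X x w)‖ ≤ ∑ x, ‖a x‖ * ‖X x w‖ := by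
          refine (norm_sum_le _ _).trans (Finset.sum_le_sum fun x _ => ?_)
          rw [norm_mul, hε, one_mul]
          exact norm_inner_le_norm _ _
      _ ≤ Real.sqrt (∑ x, ‖a x‖ ^ 2) * Real.sqrt (∑ x, ‖X x w‖ ^ 2) :=
          Real.sum_mul_le_sqrt_mul_sqrt _ _ _
      _ = Real.sqrt A * ‖w‖ := by rw [hXn, Real.sqrt_sq (norm_nonneg _)]
      _ ≤ Real.sqrt A * Real.sqrt B := by gcongr
  have hone : ∑ x, ∑ y, Real.sqrt (u x) * Real.sqrt (v y) * ‖m x y‖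
      ≤ Real.sqrt c * (Real.sqrt A * Real.sqrt B) := by
    calc ∑ x, ∑ y, Real.sqrt (u x) * Real.sqrt (v y) * ‖m x y‖
        ≤ ∑ x, ∑ y, Real.sqrt c * ((Real.sqrt (u x) * ‖a x‖) * (Real.sqrt (v y) * ‖b y‖)) := by
          refine Finset.sum_le_sum fun x _ => Finset.sum_le_sum fun y _ => ?_
          have : ‖m x y‖ ≤ ‖a x‖ * (Real.sqrt c * ‖b y‖) :=
            (norm_inner_le_norm _ _).trans (by gcongr; exact hXY _ _ _)
          calc _ ≤ Real.sqrt (u x) * Real.sqrt (v y) * (‖a x‖ * (Real.sqrt c * ‖b y‖)) := by gcongr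
            _ = _ := by ring
      _ = Real.sqrt c * ((∑ x, Real.sqrt (u x) * ‖a x‖) * ∑ y, Real.sqrt (v y) * ‖b y‖) := by
          rw [Finset.sum_mul_sum, Finset.mul_sum]
          simp only [Finset.mul_sum]
      _ ≤ Real.sqrt c * (Real.sqrt A * Real.sqrt B) := by
          have h1 : ∑ x, Real.sqrt (u x) * ‖a x‖ ≤ Real.sqrt A := by
            have := Real.sum_mul_le_sqrt_mul_sqrt Finset.univ (fun x => Real.sqrt (u x))
              fun x => ‖a x‖
            simpa only [Real.sq_sqrt (hu _), hu1, Real.sqrt_one, one_mul] using this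
          have h2 : ∑ y, Real.sqrt (v y) * ‖b y‖ ≤ Real.sqrt B := by
            have := Real.sum_mul_le_sqrt_mul_sqrt Finset.univ (fun y => Real.sqrt (v y))
              fun y => ‖b y‖
            simpa only [Real.sq_sqrt (hv _), hv1, Real.sqrt_one, one_mul] using this
          have h3 : 0 ≤ ∑ x, Real.sqrt (u x) * ‖a x‖ := Finset.sum_nonneg fun _ _ => by positivity
          have h4 : 0 ≤ ∑ y, Real.sqrt (v y) * ‖b y‖ := Finset.sum_nonneg fun _ _ => by positivity
          gcongr
  have key := norm_sum_rpow_mul_le_interp hu hv (m := m)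
    (fun x y h => by simp [m, ha0 x h]) (fun x y h => by simp [m, hb0 y h]) hphase hone hs0.le hs1
  -- After the weights cancel, completeness of `Y` reassembles `ψ`. Where `v y = 0`, both sides
  -- vanish by `hvψ`.
  have hval : ∑ x, ∑ y, ((u x ^ (s / 2) * v y ^ (s / 2) : ℝ) : ℂ) * m x y = (A : ℂ) := by
    have hb' : ∀ y, ((v y ^ (s / 2) : ℝ) : ℂ) • b y = Y y ψ := by
      intro y
      rcases (hv y).eq_or_lt with hy | hy
      · rw [hvψ y hy.symm, hb0 y hy.symm, smul_zero]
      · simp only [b]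
        rw [smul_smul, ← Complex.ofReal_mul, ← Real.rpow_add hy]
        simp
    rw [hA, Complex.ofReal_sum]
    refine Finset.sum_congr rfl fun x _ => ?_
    calc ∑ y, ((u x ^ (s / 2) * v y ^ (s / 2) : ℝ) : ℂ) * m x y
        = ∑ y, inner ℂ (a x) (((u x ^ (s / 2) : ℝ) : ℂ) •
            X x ((Y y).adjoint (((v y ^ (s / 2) : ℝ) : ℂ) • b y))) := by
          refine Finset.sum_congr rfl fun y _ => ?_
          simp only [m, map_smul, inner_smul_right]
          push_cast
          ring
      _ = inner ℂ (a x) (a x) := by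
          simp only [hb']
          rw [← inner_sum, ← Finset.smul_sum, ← map_sum, hY]
      _ = _ := by rw [inner_self_eq_norm_sq_to_K]; simp
  set N := Real.sqrt A * Real.sqrt B with hN
  have hN0 : 0 ≤ N := by positivity
  rw [hval, Complex.norm_real, Real.norm_of_nonneg hA0, Real.mul_rpow (Real.sqrt_nonneg c) hN0,
    mul_left_comm] at key
  -- Both edges of the strip carry the same `N = √A √B`, so `key` becomes `A ≤ c^(s/2) √A √B`;
  -- cancelling `√A` and squaring finishes.
  have hNN : N ^ (1 - s) * N ^ s = N := by
    rw [← Real.rpow_add_of_nonneg hN0 (by linarith) hs0.le]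
    simp
  rw [hNN, Real.sqrt_eq_rpow c, ← Real.rpow_mul hc, show (1 / 2 : ℝ) * s = s / 2 by ring] at key
  have hsA := Real.sq_sqrt hA0
  have hsB := Real.sq_sqrt hB0
  rw [← hpow c hc s]
  rcases (Real.sqrt_nonneg A).eq_or_lt with h | h
  · rw [(Real.sqrt_eq_zero hA0).1 h.symm]
    positivity
  · have h2 : Real.sqrt A ≤ c ^ (s / 2) * Real.sqrt B := by
      rw [hN] at key
      by_contra! hcon
      nlinarith
    calc A = Real.sqrt A ^ 2 := hsA.symm
      _ ≤ (c ^ (s / 2) * Real.sqrt B) ^ 2 := by gcongr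
      _ = _ := by rw [mul_pow, hsB]

/-! ### Frobenius norm -/

section Frobenius
variable {n : Type*} [Fintype n]

theorem Matrix.trace_mul_conjTranspose_eq_sum_norm_sq (A : Matrix n n ℂ) :
    (A * Aᴴ).trace = ((∑ a, ∑ b, ‖A a b‖ ^ 2 : ℝ) : ℂ) := by
  simp only [Matrix.trace, Matrix.diag, Matrix.mul_apply, Matrix.conjTranspose_apply]
  push_cast
  refine Finset.sum_congr rfl fun a _ => Finset.sum_congr rfl fun b _ => ?_
  exact Complex.mul_conj' _

/-- The operator norm is at most the Frobenius norm. The latter is used for overlaps because it is a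
trace, which can be expanded in the coupling. -/
theorem norm_toEuclideanCLM_apply_le [DecidableEq n] (A : Matrix n n ℂ) (w : EuclideanSpace ℂ n) :
    ‖Matrix.toEuclideanCLM (𝕜 := ℂ) A w‖ ≤ Real.sqrt (A * Aᴴ).trace.re * ‖w‖ := by
  rw [Matrix.trace_mul_conjTranspose_eq_sum_norm_sq, Complex.ofReal_re, EuclideanSpace.norm_eq,
    EuclideanSpace.norm_eq, ← Real.sqrt_mul (by positivity)]
  refine Real.sqrt_le_sqrt ?_
  rw [Finset.sum_mul]
  refine Finset.sum_le_sum fun a _ => ?_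
  rw [Matrix.ofLp_toEuclideanCLM, Matrix.mulVec, dotProduct]
  calc ‖∑ b, A a b * w b‖ ^ 2 ≤ (∑ b, ‖A a b‖ * ‖w b‖) ^ 2 := by
        gcongr
        exact (norm_sum_le _ _).trans (by simp)
    _ ≤ _ := Finset.sum_mul_sq_le_sq_mul_sq _ _ _

end Frobenius

/-! ### Outcome probabilities and the dual inequality for states -/

section Kraus
variable {n : Type*} [Fintype n] [DecidableEq n]

open MatrixOrder in
theorem Matrix.PosSemidef.exists_eq_mul_conjTranspose {ρ : Matrix n n ℂ} (hρ : ρ.PosSemidef) :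
    ∃ B : Matrix n n ℂ, ρ = B * Bᴴ := by
  classical
  obtain ⟨B, hB⟩ := CStarAlgebra.nonneg_iff_eq_mul_star_self.mp hρ.nonneg
  exact ⟨B, hB⟩

/-- The `k`-th column of a matrix, as a vector of the Hilbert space. -/
def colVec (B : Matrix n n ℂ) (k : n) : EuclideanSpace ℂ n := WithLp.toLp 2 fun a => B a k

/-- The columns of `B` decompose `B * Bᴴ` into unnormalised pure states, which reduces statements
about states to vectors. -/
theorem trace_kraus_eq_sum_norm_sq (X B : Matrix n n ℂ) :
    (X * (B * Bᴴ) * Xᴴ).trace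
      = ((∑ k, ‖Matrix.toEuclideanCLM (𝕜 := ℂ) X (colVec B k)‖ ^ 2 : ℝ) : ℂ) := by
  have h : X * (B * Bᴴ) * Xᴴ = (X * B) * (X * B)ᴴ := by
    rw [Matrix.conjTranspose_mul]
    simp only [Matrix.mul_assoc]
  rw [h, Matrix.trace_mul_conjTranspose_eq_sum_norm_sq, Finset.sum_comm]
  congr 1
  refine Finset.sum_congr rfl fun k _ => ?_
  rw [EuclideanSpace.norm_sq_eq]
  rfl

/-- The probability of the outcome with Kraus operator `X` in the state `ρ`. -/
def outcomeProb (X ρ : Matrix n n ℂ) : ℝ := (X * ρ * Xᴴ).trace.re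

theorem outcomeProb_mul_conjTranspose (X B : Matrix n n ℂ) :
    outcomeProb X (B * Bᴴ) = ∑ k, ‖Matrix.toEuclideanCLM (𝕜 := ℂ) X (colVec B k)‖ ^ 2 := by
  rw [outcomeProb, trace_kraus_eq_sum_norm_sq, Complex.ofReal_re]

theorem outcomeProb_nonneg (X : Matrix n n ℂ) {ρ : Matrix n n ℂ} (hρ : IsDensity ρ) :
    0 ≤ outcomeProb X ρ := by
  obtain ⟨B, rfl⟩ := hρ.1.exists_eq_mul_conjTranspose
  rw [outcomeProb_mul_conjTranspose]
  positivity

theorem trace_eq_outcomeProb (X : Matrix n n ℂ) {ρ : Matrix n n ℂ} (hρ : IsDensity ρ) :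
    (X * ρ * Xᴴ).trace = (outcomeProb X ρ : ℂ) := by
  obtain ⟨B, rfl⟩ := hρ.1.exists_eq_mul_conjTranspose
  rw [outcomeProb_mul_conjTranspose, trace_kraus_eq_sum_norm_sq]

theorem sum_outcomeProb {ι : Type*} [Fintype ι] {X : ι → Matrix n n ℂ} (hX : KrausComplete X)
    {ρ : Matrix n n ℂ} (hρ : IsDensity ρ) : ∑ x, outcomeProb (X x) ρ = 1 := by
  have h : ∑ x, (X x * ρ * (X x)ᴴ).trace = 1 := by
    have h1 : ∀ x, (X x * ρ * (X x)ᴴ).trace = ((X x)ᴴ * X x * ρ).trace := by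
      intro x
      rw [Matrix.trace_mul_comm, Matrix.mul_assoc]
    simp only [h1]
    rw [← Matrix.trace_sum, ← Finset.sum_mul, hX, one_mul, hρ.2]
  have h2 := congrArg Complex.re h
  rwa [Complex.re_sum, Complex.one_re] at h2

theorem KrausComplete.sum_adjoint_apply {ι : Type*} [Fintype ι] {X : ι → Matrix n n ℂ}
    (hX : KrausComplete X) (w : EuclideanSpace ℂ n) :
    ∑ x, (Matrix.toEuclideanCLM (𝕜 := ℂ) (X x)).adjoint (Matrix.toEuclideanCLM (𝕜 := ℂ) (X x) w)
      = w := by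
  have h := congrArg (Matrix.toEuclideanCLM (𝕜 := ℂ)) hX
  rw [map_sum, map_one] at h
  have h2 := congrArg (fun T : EuclideanSpace ℂ n →L[ℂ] EuclideanSpace ℂ n => T w) h
  simp only [sum_apply, one_apply_eq_self] at h2
  conv_rhs => rw [← h2]
  refine Finset.sum_congr rfl fun x _ => ?_
  rw [map_mul, ← Matrix.star_eq_conjTranspose, map_star]
  rfl

/-- For density operators `ρ` and families of Kraus operators `X`, `Y` such that `c` bounds the
squared Frobenius norms of `X x * (Y y)ᴴ`, the outcome distributions satisfy the weighted
inequality which is dual to the Maassen–Uffink bound. -/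
theorem sum_rpow_mul_outcomeProb_le {ι κ : Type*} [Fintype ι] [Fintype κ]
    {X : ι → Matrix n n ℂ} {Y : κ → Matrix n n ℂ} (hX : KrausComplete X) (hY : KrausComplete Y)
    {c : ℝ} (hc : 0 ≤ c)
    (hXY : ∀ x y, ((X x * (Y y)ᴴ) * (X x * (Y y)ᴴ)ᴴ).trace.re ≤ c)
    {ρ : Matrix n n ℂ} (hρ : IsDensity ρ) {u : ι → ℝ} {v : κ → ℝ}
    (hu : ∀ x, 0 ≤ u x) (hv : ∀ y, 0 ≤ v y)
    (hu1 : ∑ x, u x = 1) (hv1 : ∑ y, v y = 1) (hvρ : ∀ y, v y = 0 → outcomeProb (Y y) ρ = 0)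
    {s : ℝ} (hs0 : 0 < s) (hs1 : s ≤ 1) :
    ∑ x, u x ^ s * outcomeProb (X x) ρ ≤ c ^ s * ∑ y, v y ^ (-s) * outcomeProb (Y y) ρ := by
  obtain ⟨B, rfl⟩ := hρ.1.exists_eq_mul_conjTranspose
  simp only [outcomeProb_mul_conjTranspose, Finset.mul_sum] at hvρ ⊢
  rw [Finset.sum_comm]
  conv_rhs => rw [Finset.sum_comm]
  -- The inequality is linear in the probabilities and the weights do not depend on `k`, so it
  -- suffices to treat each column.
  refine Finset.sum_le_sum fun k _ => ?_
  rw [← Finset.mul_sum]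
  refine sum_rpow_mul_norm_sq_le (X := fun x => Matrix.toEuclideanCLM (𝕜 := ℂ) (X x))
    (Y := fun y => Matrix.toEuclideanCLM (𝕜 := ℂ) (Y y)) hX.sum_adjoint_apply
    hY.sum_adjoint_apply hc ?_ hu hv hu1 hv1 _ ?_ hs0 hs1
  · intro x y w
    have h : Matrix.toEuclideanCLM (𝕜 := ℂ) (X x)
        ((Matrix.toEuclideanCLM (𝕜 := ℂ) (Y y)).adjoint w)
        = Matrix.toEuclideanCLM (𝕜 := ℂ) (X x * (Y y)ᴴ) w := by
      rw [map_mul, ← Matrix.star_eq_conjTranspose, map_star]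
      rfl
    rw [h]
    refine (norm_toEuclideanCLM_apply_le _ _).trans ?_
    gcongr
    exact hXY x y
  · intro y hy
    have h := (Finset.sum_eq_zero_iff_of_nonneg fun _ _ => by positivity).1 (hvρ y hy) k
      (Finset.mem_univ k)
    simpa using h

end Kraus

/-! ### Spectrum of a diagonal register state -/

section SpectralValues
variable {ι : Type*} [Fintype ι] [DecidableEq ι]

/-- Both multisets are the roots of the characteristic polynomial. Multisets are compared because
the eigenvalues may come in another order. -/
theorem map_spectralValues_diagonal (P : ι → ℝ) :
    Finset.univ.val.map (spectralValues (Matrix.diagonal fun x => (P x : ℂ)))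
      = Finset.univ.val.map P := by
  have hherm : (Matrix.diagonal fun x => (P x : ℂ)).IsHermitian := by
    rw [Matrix.isHermitian_diagonal_iff]
    intro x
    exact Complex.conj_ofReal _
  rw [spectralValues, dif_pos hherm]
  have h := hherm.roots_charpoly_eq_eigenvalues
  have hroots : ∏ x, (Polynomial.X - Polynomial.C (P x : ℂ))
      = ((Finset.univ.val.map fun x => (P x : ℂ)).map
          fun a => Polynomial.X - Polynomial.C a).prod := by
    rw [Multiset.map_map]
    rfl
  rw [Matrix.charpoly_diagonal, hroots, Polynomial.roots_multiset_prod_X_sub_C] at h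
  apply Multiset.map_injective Complex.ofReal_injective
  rw [Multiset.map_map, Multiset.map_map]
  exact h.symm

theorem sum_spectralValues_diagonal (P : ι → ℝ) (h : ℝ → ℝ) :
    ∑ k, h (spectralValues (Matrix.diagonal fun x => (P x : ℂ)) k) = ∑ x, h (P x) := by
  have := congrArg (fun m => (m.map h).sum) (map_spectralValues_diagonal P)
  rw [Multiset.map_map, Multiset.map_map] at this
  exact this

theorem iSup_spectralValues_diagonal (P : ι → ℝ) :
    ⨆ k, spectralValues (Matrix.diagonal fun x => (P x : ℂ)) k = ⨆ x, P x := by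
  have h : Set.range (spectralValues (Matrix.diagonal fun x => (P x : ℂ))) = Set.range P := by
    ext r
    have := congrArg (fun m => r ∈ m) (map_spectralValues_diagonal P)
    simpa using this
  rw [iSup, h, iSup]

end SpectralValues

/-! ### From the dual inequality to entropies -/

section Classical
variable {ι κ : Type*} [Fintype ι] [Fintype κ]

/-- The inequality between two finite distributions which is dual to the Maassen–Uffink bound with
overlap `c`. -/
def DualBound (P : ι → ℝ) (Q : κ → ℝ) (c : ℝ) : Prop :=
  ∀ (u : ι → ℝ) (v : κ → ℝ) (s : ℝ), (∀ x, 0 ≤ u x) → (∀ y, 0 ≤ v y) → ∑ x, u x = 1 →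
    ∑ y, v y = 1 → (∀ y, v y = 0 → Q y = 0) → 0 < s → s ≤ 1 →
    ∑ x, u x ^ s * P x ≤ c ^ s * ∑ y, v y ^ (-s) * Q y

theorem sum_rpow_pos {P : ι → ℝ} (hP : ∀ x, 0 ≤ P x) (hP1 : ∑ x, P x = 1) (α : ℝ) :
    0 < ∑ x, P x ^ α := by
  obtain ⟨x, hx, hx0⟩ := Finset.exists_ne_zero_of_sum_ne_zero (by rw [hP1]; exact one_ne_zero)
  exact Finset.sum_pos' (fun y _ => Real.rpow_nonneg (hP y) α)
    ⟨x, hx, Real.rpow_pos_of_pos ((hP x).lt_of_ne' hx0) α⟩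

/-- The weights `v ∝ Q^(1/(1+s))` are the minimiser of `∑ v^(-s) Q` given by Lagrange multipliers.
-/
theorem DualBound.sum_rpow_mul_le {P : ι → ℝ} {Q : κ → ℝ} {c : ℝ} (h : DualBound P Q c)
    (hQ : ∀ y, 0 ≤ Q y) (hQ1 : ∑ y, Q y = 1) {s : ℝ} (hs0 : 0 < s) (hs1 : s ≤ 1) {u : ι → ℝ}
    (hu : ∀ x, 0 ≤ u x) (hu1 : ∑ x, u x = 1) :
    ∑ x, u x ^ s * P x ≤ c ^ s * (∑ y, Q y ^ (1 + s)⁻¹) ^ (1 + s) := by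
  set β := (1 + s)⁻¹ with hβ
  have hβ0 : 0 < β := by positivity
  have hβs : β * (1 + s) = 1 := inv_mul_cancel₀ (by positivity)
  set S := ∑ y, Q y ^ β with hS
  have hS0 : 0 < S := sum_rpow_pos hQ hQ1 β
  have key := h u (fun y => Q y ^ β / S) s hu
    (fun y => div_nonneg (Real.rpow_nonneg (hQ y) _) hS0.le) hu1
    (by rw [← Finset.sum_div, ← hS, div_self hS0.ne'])
    (fun y hy => by
      rcases div_eq_zero_iff.1 hy with h' | h'
      · exact (Real.rpow_eq_zero (hQ y) hβ0.ne').1 h'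
      · exact absurd h' hS0.ne') hs0 hs1
  refine key.trans_eq ?_
  congr 1
  calc ∑ y, (Q y ^ β / S) ^ (-s) * Q y = ∑ y, Q y ^ β * S ^ s := by
        refine Finset.sum_congr rfl fun y _ => ?_
        rcases (hQ y).eq_or_lt with hy | hy
        · rw [← hy, Real.zero_rpow hβ0.ne']; simp
        · rw [Real.div_rpow (by positivity) hS0.le, ← Real.rpow_mul hy.le, Real.rpow_neg hS0.le,
            div_inv_eq_mul, mul_right_comm]
          congr 1
          nth_rw 2 [← Real.rpow_one (Q y)]
          rw [← Real.rpow_add hy]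
          congr 1
          linarith
    _ = S ^ (1 + s) := by
        rw [← Finset.sum_mul, ← hS, Real.rpow_add hS0, Real.rpow_one]

/-- With `s = 1 - 1/α`, conjugacy means `β = 1/(1+s)`, and `u ∝ P^α` turns the left side into `(∑
P^α)^(1/α)`. Taking logarithms and dividing by `s` gives the claim. -/
theorem DualBound.renyi {P : ι → ℝ} {Q : κ → ℝ} {c : ℝ} (h : DualBound P Q c) (hc : 0 < c)
    (hP : ∀ x, 0 ≤ P x) (hP1 : ∑ x, P x = 1) (hQ : ∀ y, 0 ≤ Q y) (hQ1 : ∑ y, Q y = 1)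
    {α β : ℝ} (hα : 1 < α) (hαβ : α⁻¹ + β⁻¹ = 2) :
    -Real.logb 2 c ≤ 1 / (1 - α) * Real.logb 2 (∑ x, P x ^ α)
      + 1 / (1 - β) * Real.logb 2 (∑ y, Q y ^ β) := by
  set s := 1 - α⁻¹ with hs
  have hα0 : 0 < α := by linarith
  have hαinv : α⁻¹ < 1 := inv_lt_one_of_one_lt₀ hα
  have hαinv0 : 0 < α⁻¹ := by positivity
  have hs0 : 0 < s := by linarith
  have hs1 : s ≤ 1 := by linarith
  have hβ : β = (1 + s)⁻¹ := by rw [← inv_inv β]; congr 1; linarith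
  set S := ∑ x, P x ^ α with hS
  have hS0 : 0 < S := sum_rpow_pos hP hP1 α
  have hT0 : 0 < ∑ y, Q y ^ β := sum_rpow_pos hQ hQ1 β
  have key := h.sum_rpow_mul_le hQ hQ1 hs0 hs1 (u := fun x => P x ^ α / S)
    (fun x => div_nonneg (Real.rpow_nonneg (hP x) _) hS0.le)
    (by rw [← Finset.sum_div, ← hS, div_self hS0.ne'])
  have hleft : ∑ x, (P x ^ α / S) ^ s * P x = S ^ (1 - s) := by
    calc ∑ x, (P x ^ α / S) ^ s * P x = ∑ x, P x ^ α * S ^ (-s) := by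
          refine Finset.sum_congr rfl fun x _ => ?_
          rcases (hP x).eq_or_lt with hx | hx
          · rw [← hx, Real.zero_rpow hα0.ne']; simp
          · rw [Real.div_rpow (by positivity) hS0.le, ← Real.rpow_mul hx.le, Real.rpow_neg hS0.le,
              div_eq_mul_inv, mul_right_comm]
            congr 1
            nth_rw 2 [← Real.rpow_one (P x)]
            rw [← Real.rpow_add hx]
            congr 1
            rw [hs]
            field_simp
            ring
      _ = S ^ (1 - s) := by
          rw [← Finset.sum_mul, ← hS, sub_eq_add_neg, Real.rpow_add hS0, Real.rpow_one]
  rw [hleft, ← hβ] at key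
  set T := ∑ y, Q y ^ β with hT
  have hlog := Real.logb_le_logb_of_le (b := 2) (by norm_num) (by positivity) key
  rw [Real.logb_mul (by positivity) (by positivity), Real.logb_rpow_eq_mul_logb_of_pos hS0,
    Real.logb_rpow_eq_mul_logb_of_pos hT0, Real.logb_rpow_eq_mul_logb_of_pos hc] at hlog
  have h1 : 1 / (1 - α) = -((1 - s) / s) := by
    have : α = (1 - s)⁻¹ := by rw [hs]; simp
    have h1s : 1 - s ≠ 0 := by linarith
    rw [this, one_div, show 1 - (1 - s)⁻¹ = -(s / (1 - s)) by field_simp; ring, inv_neg, inv_div]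
  have h2 : 1 / (1 - β) = (1 + s) / s := by
    rw [hβ, one_div, show 1 - (1 + s)⁻¹ = s / (1 + s) by field_simp; ring, inv_div]
  rw [h1, h2]
  have h3 : -((1 - s) / s) * Real.logb 2 S + (1 + s) / s * Real.logb 2 T
      = ((1 + s) * Real.logb 2 T - (1 - s) * Real.logb 2 S) / s := by ring
  rw [h3, le_div_iff₀ hs0]
  linarith

theorem DualBound.min_renyi {P : ι → ℝ} {Q : κ → ℝ} {c : ℝ} (h : DualBound P Q c) (hc : 0 < c)
    (hP : ∀ x, 0 ≤ P x) (hP1 : ∑ x, P x = 1) (hQ : ∀ y, 0 ≤ Q y) (hQ1 : ∑ y, Q y = 1) :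
    -Real.logb 2 c ≤ -Real.logb 2 (⨆ x, P x)
      + 1 / (1 - (2 : ℝ)⁻¹) * Real.logb 2 (∑ y, Q y ^ (2 : ℝ)⁻¹) := by
  classical
  obtain ⟨z, -, hz0⟩ := Finset.exists_ne_zero_of_sum_ne_zero (by rw [hP1]; exact one_ne_zero)
  have : Nonempty ι := ⟨z⟩
  obtain ⟨x, hx⟩ := exists_eq_ciSup_of_finite (f := P)
  have hpos : 0 < P x := by
    rw [hx]
    exact ((hP z).lt_of_ne' hz0).trans_le (le_ciSup (Set.finite_range P).bddAbove z)
  rw [← hx]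
  -- The endpoint `α = ∞`, `β = 1/2` is `s = 1`, with `u` concentrated on a most likely outcome.
  have key := h.sum_rpow_mul_le hQ hQ1 one_pos le_rfl (u := Pi.single x 1)
    (fun y => by
      rcases eq_or_ne y x with rfl | hy
      · simp
      · simp [hy]) (by simp)
  have hT0 : 0 < ∑ y, Q y ^ (2 : ℝ)⁻¹ := sum_rpow_pos hQ hQ1 _
  have hleft : ∑ y, (Pi.single x (1 : ℝ) : ι → ℝ) y ^ (1 : ℝ) * P y = P x := by
    simp [Pi.single_apply]
  rw [hleft, Real.rpow_one, show (1 : ℝ) + 1 = 2 by norm_num] at key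
  have hlog := Real.logb_le_logb_of_le (b := 2) (by norm_num) hpos key
  rw [Real.logb_mul (by positivity) (by positivity),
    Real.logb_rpow_eq_mul_logb_of_pos hT0] at hlog
  norm_num at hlog ⊢
  linarith

/-- With `u = P` and `v = Q` both sides of the dual inequality tend to `1` as `s → 0`, so their
derivatives at `0` are ordered as well. -/
theorem DualBound.shannon {P : ι → ℝ} {Q : κ → ℝ} {c : ℝ} (h : DualBound P Q c) (hc : 0 < c)
    (hP : ∀ x, 0 ≤ P x) (hP1 : ∑ x, P x = 1) (hQ : ∀ y, 0 ≤ Q y) (hQ1 : ∑ y, Q y = 1) :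
    -Real.logb 2 c ≤ -∑ x, P x * Real.logb 2 (P x) + -∑ y, Q y * Real.logb 2 (Q y) := by
  -- Exponentials make `φ` differentiable at `0` even if some probabilities vanish; the prefactors
  -- `P x`, `Q y` remove those terms.
  let φ : ℝ → ℝ := fun s => Real.exp (s * Real.log c) * ∑ y, Q y * Real.exp (-s * Real.log (Q y))
    - ∑ x, P x * Real.exp (s * Real.log (P x))
  have hφ0 : φ 0 = 0 := by simp [φ, hP1, hQ1]
  have hexp : ∀ r : ℝ, 0 ≤ r → ∀ t : ℝ, r ^ t * r = r * Real.exp (t * Real.log r) := by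
    intro r hr t
    rcases hr.eq_or_lt with h0 | h0
    · simp [← h0]
    · rw [Real.rpow_def_of_pos h0, mul_comm, mul_comm t]
  have hφ : ∀ s, 0 < s → s ≤ 1 → 0 ≤ φ s := by
    intro s hs0 hs1
    have key := h P Q s hP hQ hP1 hQ1 (fun _ => id) hs0 hs1
    simp only [hexp _ (hP _), hexp _ (hQ _)] at key
    rw [Real.rpow_def_of_pos hc, mul_comm (Real.log c)] at key
    exact sub_nonneg.2 key
  have hderiv : HasDerivAt φ (Real.log c - ∑ y, Q y * Real.log (Q y)
      - ∑ x, P x * Real.log (P x)) 0 := by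
    have h1 : ∀ r a : ℝ, HasDerivAt (fun s : ℝ => r * Real.exp (s * a)) (r * a) 0 := by
      intro r a
      have := (((hasDerivAt_id (0 : ℝ)).mul_const a).exp).const_mul r
      simpa using this
    have h2 := HasDerivAt.fun_sum (u := Finset.univ) fun y (_ : y ∈ Finset.univ) =>
      h1 (Q y) (-Real.log (Q y))
    have h3 := HasDerivAt.fun_sum (u := Finset.univ) fun x (_ : x ∈ Finset.univ) =>
      h1 (P x) (Real.log (P x))
    have h4 := ((h1 1 (Real.log c)).mul h2).sub h3
    refine (h4.congr_deriv ?_).congr_of_eventuallyEq (Eventually.of_forall fun s => ?_)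
    · simp [hQ1, sub_eq_add_neg]
    · simp [φ, mul_neg, neg_mul]
  have hnonneg : 0 ≤ Real.log c - ∑ y, Q y * Real.log (Q y) - ∑ x, P x * Real.log (P x) := by
    refine ge_of_tendsto hderiv.tendsto_slope_zero_right ?_
    filter_upwards [Ioc_mem_nhdsGT (zero_lt_one' ℝ)] with s hs
    rw [zero_add, hφ0, sub_zero, smul_eq_mul]
    exact mul_nonneg (inv_nonneg.2 hs.1.le) (hφ s hs.1 hs.2)
  have hlog2 : 0 < Real.log 2 := Real.log_pos (by norm_num)
  simp only [Real.logb, mul_div_assoc']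
  rw [← Finset.sum_div, ← Finset.sum_div, ← neg_div, ← neg_div, ← neg_div, ← add_div]
  gcongr
  linarith

end Classical

/-! ### Entropic uncertainty relations for two measurements -/

section Register
variable {n : Type*} [Fintype n] [DecidableEq n]

theorem registerState_eq_diagonal_outcomeProb {ι : Type*} [DecidableEq ι]
    (X : ι → Matrix n n ℂ) {ρ : Matrix n n ℂ} (hρ : IsDensity ρ) :
    registerState X ρ = Matrix.diagonal fun x => (outcomeProb (X x) ρ : ℂ) := by
  rw [registerState]
  congr 1
  funext x
  exact trace_eq_outcomeProb _ hρ

variable {ι κ : Type*} [Fintype ι] [Fintype κ] {X : ι → Matrix n n ℂ} {Y : κ → Matrix n n ℂ} {ρ : Matrix n n ℂ} {c : ℝ}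

theorem dualBound_outcomeProb (hX : KrausComplete X) (hY : KrausComplete Y)
    (hc : 0 ≤ c) (hXY : ∀ x y, ((X x * (Y y)ᴴ) * (X x * (Y y)ᴴ)ᴴ).trace.re ≤ c)
    (hρ : IsDensity ρ) :
    DualBound (fun x => outcomeProb (X x) ρ) (fun y => outcomeProb (Y y) ρ) c :=
  fun _ _ _ hu hv hu1 hv1 hvρ hs0 hs1 =>
    sum_rpow_mul_outcomeProb_le hX hY hc hXY hρ hu hv hu1 hv1 hvρ hs0 hs1

variable [DecidableEq ι] [DecidableEq κ]

/-- The entropic uncertainty relation for the von Neumann entropies of two measurements. -/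
theorem vonNeumannEntropy_add_ge (hX : KrausComplete X) (hY : KrausComplete Y)
    (hc : 0 < c) (hXY : ∀ x y, ((X x * (Y y)ᴴ) * (X x * (Y y)ᴴ)ᴴ).trace.re ≤ c)
    (hρ : IsDensity ρ) :
    -Real.logb 2 c ≤ vonNeumannEntropy (registerState X ρ)
      + vonNeumannEntropy (registerState Y ρ) := by
  rw [registerState_eq_diagonal_outcomeProb X hρ, registerState_eq_diagonal_outcomeProb Y hρ,
    vonNeumannEntropy, vonNeumannEntropy,
    sum_spectralValues_diagonal _ fun r => r * Real.logb 2 r,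
    sum_spectralValues_diagonal _ fun r => r * Real.logb 2 r]
  exact (dualBound_outcomeProb hX hY hc.le hXY hρ).shannon hc (fun _ => outcomeProb_nonneg _ hρ)
    (sum_outcomeProb hX hρ) (fun _ => outcomeProb_nonneg _ hρ) (sum_outcomeProb hY hρ)

/-- The dual inequality is asymmetric: the family weighted by `u^s` receives the order above `1`. -/
theorem renyiEntropy_add_ge_of_one_lt (hX : KrausComplete X) (hY : KrausComplete Y)
    (hc : 0 < c) (hXY : ∀ x y, ((X x * (Y y)ᴴ) * (X x * (Y y)ᴴ)ᴴ).trace.re ≤ c)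
    (hρ : IsDensity ρ) {α β : ℝ≥0∞} (hα : 1 < α) (hαβ : α⁻¹ + β⁻¹ = 2) :
    -Real.logb 2 c ≤ renyiEntropy α (registerState X ρ)
      + renyiEntropy β (registerState Y ρ) := by
  have hD := dualBound_outcomeProb hX hY hc.le hXY hρ
  have hP : ∀ x, 0 ≤ outcomeProb (X x) ρ := fun _ => outcomeProb_nonneg _ hρ
  have hQ : ∀ y, 0 ≤ outcomeProb (Y y) ρ := fun _ => outcomeProb_nonneg _ hρ
  rw [registerState_eq_diagonal_outcomeProb X hρ, registerState_eq_diagonal_outcomeProb Y hρ]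
  by_cases hαt : α = ∞
  · subst hαt
    have hβ : β = 2⁻¹ := by
      rw [ENNReal.inv_top, zero_add] at hαβ
      rw [← hαβ, inv_inv]
    subst hβ
    have hβ1 : (2⁻¹ : ℝ≥0∞) ≠ 1 := by
      intro h
      rw [ENNReal.inv_eq_one] at h
      norm_num at h
    rw [renyiEntropy, if_neg ENNReal.top_ne_one, if_pos rfl, renyiEntropy, if_neg hβ1,
      if_neg (by simp), iSup_spectralValues_diagonal,
      sum_spectralValues_diagonal _ fun r => r ^ (2⁻¹ : ℝ≥0∞).toReal, ENNReal.toReal_inv]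
    exact hD.min_renyi hc hP (sum_outcomeProb hX hρ) hQ (sum_outcomeProb hY hρ)
  · have hα0 : α ≠ 0 := (zero_lt_one.trans hα).ne'
    have hβ0 : β ≠ 0 := by
      rintro rfl
      simp at hαβ
    have hreal : α.toReal⁻¹ + β.toReal⁻¹ = 2 := by
      have h := congrArg ENNReal.toReal hαβ
      rw [ENNReal.toReal_add (by simpa using hα0) (by simpa using hβ0), ENNReal.toReal_inv,
        ENNReal.toReal_inv] at h
      simpa using h
    have hα1 : 1 < α.toReal := by
      rw [← ENNReal.toReal_one]
      exact (ENNReal.toReal_lt_toReal ENNReal.one_ne_top hαt).2 hα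
    have hinv : α.toReal⁻¹ < 1 := inv_lt_one_of_one_lt₀ hα1
    have hβ1 : β ≠ 1 := by
      rintro rfl
      rw [ENNReal.toReal_one] at hreal
      linarith
    have hβt : β ≠ ∞ := by
      rintro rfl
      rw [ENNReal.toReal_top] at hreal
      linarith
    rw [renyiEntropy, if_neg hα.ne', if_neg hαt, renyiEntropy, if_neg hβ1, if_neg hβt,
      sum_spectralValues_diagonal _ fun r => r ^ α.toReal,
      sum_spectralValues_diagonal _ fun r => r ^ β.toReal]
    exact hD.renyi hc hP (sum_outcomeProb hX hρ) hQ (sum_outcomeProb hY hρ) hα1 hreal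

/-- The entropic uncertainty relation for the Rényi entropies of two measurements, for conjugate
orders. -/
theorem renyiEntropy_add_ge (hX : KrausComplete X) (hY : KrausComplete Y)
    (hc : 0 < c) (hXY : ∀ x y, ((X x * (Y y)ᴴ) * (X x * (Y y)ᴴ)ᴴ).trace.re ≤ c)
    (hρ : IsDensity ρ) {α β : ℝ≥0∞} (hαβ : α⁻¹ + β⁻¹ = 2) :
    -Real.logb 2 c ≤ renyiEntropy α (registerState X ρ)
      + renyiEntropy β (registerState Y ρ) := by
  rcases lt_trichotomy 1 α with hα | hα | hα
  · exact renyiEntropy_add_ge_of_one_lt hX hY hc hXY hρ hα hαβ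
  · subst hα
    have hβ : β = 1 := by
      rw [inv_one, ← one_add_one_eq_two] at hαβ
      exact ENNReal.inv_eq_one.1 ((ENNReal.add_right_inj ENNReal.one_ne_top).1 hαβ)
    rw [hβ, renyiEntropy, if_pos rfl, renyiEntropy, if_pos rfl]
    exact vonNeumannEntropy_add_ge hX hY hc hXY hρ
  · have hβ : 1 < β := by
      by_contra! hβ
      have h1 : 1 < α⁻¹ := ENNReal.one_lt_inv.2 hα
      have h2 : 1 ≤ β⁻¹ := ENNReal.one_le_inv.2 hβ
      have h3 := ENNReal.add_lt_add_of_lt_of_le ENNReal.one_ne_top h1 h2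
      rw [hαβ, one_add_one_eq_two] at h3
      exact h3.false
    -- If `α < 1` then `β > 1`, so the families swap roles; the Frobenius norm is invariant under
    -- the adjoint.
    rw [add_comm]
    refine renyiEntropy_add_ge_of_one_lt hY hX hc (fun y x => ?_) hρ hβ (by rw [add_comm, hαβ])
    have h := hXY x y
    rw [Matrix.trace_mul_comm] at h
    simpa [Matrix.conjTranspose_mul] using h

end Register

/-! ### Overlaps of projectors and weak values -/

section Projectors
variable {n : Type*} [Fintype n]

/-- The squared Frobenius norm of `Pi * (Pf * K)ᴴ`, which bounds the overlap of an outcome of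
POVM I with an outcome of POVM II. -/
def overlap (Pf K Pi : Matrix n n ℂ) : ℝ :=
  ((Pi * (Pf * K)ᴴ) * (Pi * (Pf * K)ᴴ)ᴴ).trace.re

theorem overlap_eq {Pf Pi : Matrix n n ℂ} (hf : Pf.IsHermitian) (hf2 : Pf * Pf = Pf)
    (hi : Pi.IsHermitian) (hi2 : Pi * Pi = Pi) (K : Matrix n n ℂ) :
    overlap Pf K Pi = (Pf * K * Pi * Kᴴ).trace.re := by
  rw [overlap, Matrix.trace_mul_comm]
  simp only [Matrix.conjTranspose_mul, Matrix.conjTranspose_conjTranspose, hf.eq, hi.eq]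
  have h : Pf * K * Pi * (Pi * (Kᴴ * Pf)) = (Pf * K * Pi * Kᴴ) * Pf := by
    rw [show Pf * K * Pi * (Pi * (Kᴴ * Pf)) = Pf * K * (Pi * Pi) * Kᴴ * Pf by
      simp only [Matrix.mul_assoc], hi2]
  rw [h, Matrix.trace_mul_comm]
  simp only [← Matrix.mul_assoc, hf2]

/-- This shows that the trace is real and nonnegative. -/
theorem trace_mul_proj_eq {Pf Pi : Matrix n n ℂ} (hf : Pf.IsHermitian) (hf2 : Pf * Pf = Pf)
    (hi : Pi.IsHermitian) (hi2 : Pi * Pi = Pi) :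
    (Pf * Pi).trace = ((∑ a, ∑ b, ‖(Pf * Pi) a b‖ ^ 2 : ℝ) : ℂ) := by
  rw [← Matrix.trace_mul_conjTranspose_eq_sum_norm_sq, Matrix.conjTranspose_mul, hf.eq, hi.eq,
    show Pf * Pi * (Pi * Pf) = Pf * (Pi * Pi) * Pf by simp only [Matrix.mul_assoc], hi2,
    Matrix.trace_mul_comm (Pf * Pi), ← Matrix.mul_assoc, hf2]

theorem trace_proj_ne_zero {P : Matrix n n ℂ} (h : P.IsHermitian) (h2 : P * P = P) (h0 : P ≠ 0) :
    P.trace ≠ 0 := by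
  intro ht
  apply h0
  rw [← Matrix.trace_mul_conjTranspose_self_eq_zero_iff, h.eq, h2, ht]

/-- The factor `Tr Π_i` cancels the one in the weak value, and `1/√p = √p/p`. What remains is minus
the first-order expansion of the logarithm of the overlap. -/
theorem weakBoundTerm_eq {A Pf Pi : Matrix n n ℂ} (hf : Pf.IsHermitian) (hf2 : Pf * Pf = Pf)
    (hi : Pi.IsHermitian) (hi2 : Pi * Pi = Pi) (hi0 : Pi ≠ 0) {p : ℝ} (hp : 0 < p)
    (hT : (Pf * Pi).trace.re ≠ 0) (g : ℂ) :
    weakBoundTerm A Pi Pf p g = -(Real.logb 2 (p * (Pf * Pi).trace.re)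
      + 2 * Real.sqrt p * (g * (Pf * A * Pi).trace).re
        / (p * (Pf * Pi).trace.re * Real.log 2)) := by
  have hτ0 := trace_proj_ne_zero hi hi2 hi0
  have hτ : Pi.trace = (Pi.trace.re : ℂ) := by
    have h := trace_mul_proj_eq hi hi2 hi hi2
    rw [hi2] at h
    rw [h, Complex.ofReal_re]
  have hz : (Pf * Pi).trace = ((Pf * Pi).trace.re : ℂ) := by
    rw [trace_mul_proj_eq hf hf2 hi hi2, Complex.ofReal_re]
  rw [weakBoundTerm, weakValue]
  rw [hτ] at hτ0 ⊢
  set T := (Pf * Pi).trace.re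
  set τ := Pi.trace.re
  rw [hz, ← Complex.ofReal_mul, mul_div_assoc' g, Complex.div_ofReal_re, Complex.ofReal_re]
  have hτ0' : τ ≠ 0 := by exact_mod_cast hτ0
  have hsq := Real.sq_sqrt hp.le
  have hs : Real.sqrt p ≠ 0 := (Real.sqrt_pos.2 hp).ne'
  have hl : Real.log 2 ≠ 0 := (Real.log_pos (by norm_num)).ne'
  rw [neg_add, ← sub_eq_add_neg]
  congr 1
  nth_rw 3 [← hsq]
  field_simp

end Projectors

/-! ### First-order expansions -/

section Expansion

theorem Real.isBigO_log_one_add_sub_self :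
    (fun x : ℝ => Real.log (1 + x) - x) =O[𝓝 0] fun x : ℝ => x ^ 2 := by
  refine IsBigO.of_bound 2 ?_
  filter_upwards [Metric.ball_mem_nhds (0 : ℝ) (half_pos one_pos)] with x hx
  rw [Metric.mem_ball, dist_zero_right, Real.norm_eq_abs] at hx
  -- The one-term Taylor remainder is at most `x²/(1 - |x|)`, hence at most `2x²` for `|x| < 1/2`.
  have h := Real.abs_log_sub_add_sum_range_le (x := -x) (by rw [abs_neg]; linarith) 1
  rw [Real.norm_eq_abs, Real.norm_eq_abs, abs_pow]
  simp only [Finset.range_one, Finset.sum_singleton, abs_neg] at h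
  norm_num at h
  rw [← sub_eq_neg_add] at h
  refine h.trans ?_
  rw [div_le_iff₀ (by linarith), sq_abs]
  nlinarith [sq_nonneg x]

theorem isBigO_logb_sub {q : ℝ} (hq : 0 < q) {F L : ℝ → ℝ} (hL : L =O[𝓝 0] fun t : ℝ => t)
    (hF : (fun t => F t - (q + L t)) =O[𝓝 0] fun t : ℝ => t ^ 2) :
    (fun t => Real.logb 2 (F t) - (Real.logb 2 q + L t / (q * Real.log 2)))
      =O[𝓝 0] fun t : ℝ => t ^ 2 := by
  have hsq : (fun t : ℝ => t ^ 2) =O[𝓝 0] fun t : ℝ => t := by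
    simpa using (isLittleO_pow_pow (𝕜 := ℝ) one_lt_two).isBigO
  have hx : (fun t => F t / q - 1) =O[𝓝 0] fun t : ℝ => t := by
    have h := ((hF.trans hsq).add hL).const_mul_left q⁻¹
    refine h.congr_left fun t => ?_
    field_simp
    ring
  have hx0 : Tendsto (fun t => F t / q - 1) (𝓝 0) (𝓝 0) := hx.trans_tendsto tendsto_id
  have hlog := (Real.isBigO_log_one_add_sub_self.comp_tendsto hx0).trans (hx.pow 2)
  have hsum := (hlog.add (hF.const_mul_left q⁻¹)).const_mul_left (Real.log 2)⁻¹
  refine hsum.congr' ?_ EventuallyEq.rfl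
  filter_upwards [hx0.eventually (lt_mem_nhds (show (-1 : ℝ) < 0 by norm_num))] with t ht
  have hFq : 0 < F t / q := by linarith
  have hFt : F t ≠ 0 := by
    intro h
    simp [h] at hFq
  have hl : Real.log 2 ≠ 0 := (Real.log_pos (by norm_num)).ne'
  simp only [Function.comp_apply, add_sub_cancel]
  rw [Real.log_div hFt hq.ne', Real.logb, Real.logb]
  field_simp
  ring

variable {n : Type*} [Fintype n] {l : Filter ℝ}

theorem isBigO_mul_apply {X Y : ℝ → Matrix n n ℂ} {f h : ℝ → ℝ}
    (hX : ∀ a b, (fun t => X t a b) =O[l] f) (hY : ∀ a b, (fun t => Y t a b) =O[l] h) (a b : n) :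
    (fun t => (X t * Y t) a b) =O[l] fun t => f t * h t := by
  simp only [Matrix.mul_apply]
  exact IsBigO.fun_sum fun c _ => (hX a c).mul (hY c b)

theorem isBigO_trace_mul_mul {X Y : ℝ → Matrix n n ℂ} {f h : ℝ → ℝ} (P Q : Matrix n n ℂ)
    (hX : ∀ a b, (fun t => X t a b) =O[l] f) (hY : ∀ a b, (fun t => Y t a b) =O[l] h) :
    (fun t => (P * X t * Q * (Y t)ᴴ).trace) =O[l] fun t => f t * h t := by
  have hconst : ∀ (M : Matrix n n ℂ) (a b : n),
      (fun _ : ℝ => M a b) =O[l] fun _ : ℝ => (1 : ℝ) :=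
    fun M a b => isBigO_const_const _ one_ne_zero _
  have hYc : ∀ a b, (fun t => (Y t)ᴴ a b) =O[l] h := fun a b =>
    (IsBigO.of_norm_left ((hY b a).norm_left.congr_left fun t => by
      rw [Matrix.conjTranspose_apply, norm_star]))
  have h1 := isBigO_mul_apply (isBigO_mul_apply (isBigO_mul_apply (hconst P) hX) (hconst Q)) hYc
  simp only [one_mul, mul_one] at h1
  simp only [Matrix.trace, Matrix.diag]
  exact IsBigO.fun_sum fun a _ => h1 a a

/-- Split `K` into parts `S`, `G`, `D` of orders `0`, `1`, `2`. The terms `SG` and `GS` are complex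
conjugates because `A` is Hermitian, which produces `2 Re`; `GG` and all terms with `D` are `O(t²)`.
-/
theorem isBigO_overlap_sub [DecidableEq n] {A Pf Pi : Matrix n n ℂ} (hA : A.IsHermitian)
    (hf : Pf.IsHermitian) (hf2 : Pf * Pf = Pf) (hi : Pi.IsHermitian) (hi2 : Pi * Pi = Pi)
    {p : ℝ} (hp : 0 ≤ p) {g : ℝ → ℂ} {K : ℝ → Matrix n n ℂ} (hg : g =O[𝓝 0] fun t : ℝ => t)
    (hK : ∀ a b, (fun t : ℝ => (K t - ((Real.sqrt p : ℂ) • (1 : Matrix n n ℂ) + g t • A)) a b)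
      =O[𝓝 0] fun t : ℝ => t ^ 2) :
    (fun t => overlap Pf (K t) Pi - (p * (Pf * Pi).trace.re
      + 2 * Real.sqrt p * (g t * (Pf * A * Pi).trace).re)) =O[𝓝 0] fun t : ℝ => t ^ 2 := by
  have hone : (fun t : ℝ => t) =O[𝓝 0] fun _ : ℝ => (1 : ℝ) :=
    (continuousAt_id (x := (0 : ℝ))).isBigO_one ℝ
  have hsq : (fun t : ℝ => t ^ 2) =O[𝓝 0] fun _ : ℝ => (1 : ℝ) :=
    ((continuous_pow 2).continuousAt (x := (0 : ℝ))).isBigO_one ℝ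
  let S : ℝ → Matrix n n ℂ := fun _ => (Real.sqrt p : ℂ) • 1
  let G : ℝ → Matrix n n ℂ := fun t => g t • A
  let D : ℝ → Matrix n n ℂ := fun t => K t - (S t + G t)
  have hS : ∀ a b, (fun t => S t a b) =O[𝓝 0] fun _ : ℝ => (1 : ℝ) :=
    fun a b => isBigO_const_const _ one_ne_zero _
  have hG : ∀ a b, (fun t => G t a b) =O[𝓝 0] fun t : ℝ => t := fun a b => by
    have h := hg.mul (isBigO_const_const (A a b) (one_ne_zero (α := ℝ)) (𝓝 (0 : ℝ)))
    simp only [mul_one] at h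
    exact h
  have hD : ∀ a b, (fun t => D t a b) =O[𝓝 0] fun t : ℝ => t ^ 2 := hK
  have hSG : ∀ a b, (fun t => (S t + G t) a b) =O[𝓝 0] fun _ : ℝ => (1 : ℝ) :=
    fun a b => (hS a b).add ((hG a b).trans hone)
  have hKone : ∀ a b, (fun t => K t a b) =O[𝓝 0] fun _ : ℝ => (1 : ℝ) := fun a b => by
    refine (((hD a b).trans hsq).add (hSG a b)).congr_left fun t => ?_
    simp only [D, Matrix.sub_apply, sub_add_cancel]
  have h1 := isBigO_trace_mul_mul Pf Pi hG hG
  have h2 := isBigO_trace_mul_mul Pf Pi hD hKone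
  have h3 := isBigO_trace_mul_mul Pf Pi hSG hD
  simp only [mul_one, one_mul, ← sq] at h1 h2 h3
  have h4 := (h1.add h2).add h3
  have hre : ∀ {u : ℝ → ℂ}, u =O[𝓝 0] (fun t : ℝ => t ^ 2) →
      (fun t => (u t).re) =O[𝓝 0] fun t : ℝ => t ^ 2 := fun hu =>
    (IsBigO.of_bound 1 (Eventually.of_forall fun t => by
      simpa using Complex.abs_re_le_norm _)).trans hu
  refine (hre h4).congr_left fun t => ?_
  rw [overlap_eq hf hf2 hi hi2]
  have hKt : K t = D t + (S t + G t) := (sub_add_cancel _ _).symm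
  have hconj : (Pf * Pi * A).trace = star (Pf * A * Pi).trace := by
    rw [← Matrix.trace_conjTranspose]
    simp only [Matrix.conjTranspose_mul, hA.eq, hf.eq, hi.eq]
    rw [Matrix.trace_mul_comm (Pf * Pi) A, Matrix.trace_mul_comm Pi, Matrix.mul_assoc]
  have hSS : (Pf * S t * Pi * (S t)ᴴ).trace = (p : ℂ) * (Pf * Pi).trace := by
    have : (Real.sqrt p : ℂ) * (Real.sqrt p : ℂ) = (p : ℂ) := by
      rw [← Complex.ofReal_mul, Real.mul_self_sqrt hp]
    simp [S, ← this, mul_assoc]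
  have hSGt : (Pf * S t * Pi * (G t)ᴴ).trace
      = (Real.sqrt p : ℂ) * star (g t * (Pf * A * Pi).trace) := by
    rw [star_mul', ← hconj]
    simp [S, G, hA.eq, mul_left_comm]
  have hGSt : (Pf * G t * Pi * (S t)ᴴ).trace
      = (Real.sqrt p : ℂ) * (g t * (Pf * A * Pi).trace) := by
    simp [S, G]
  have hsplit : (Pf * K t * Pi * (K t)ᴴ).trace
      = ((Pf * G t * Pi * (G t)ᴴ).trace + (Pf * D t * Pi * (K t)ᴴ).trace
        + (Pf * (S t + G t) * Pi * (D t)ᴴ).trace)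
        + ((Pf * S t * Pi * (S t)ᴴ).trace + (Pf * S t * Pi * (G t)ᴴ).trace
          + (Pf * G t * Pi * (S t)ᴴ).trace) := by
    simp only [← Matrix.trace_add]
    congr 1
    rw [hKt]
    simp only [Matrix.conjTranspose_add]
    noncomm_ring
  rw [hsplit, hSS, hSGt, hGSt]
  simp only [Complex.add_re, Complex.re_ofReal_mul, Complex.star_def, Complex.conj_re]
  ring

end Expansion

/-! ### Completeness, and existence of an admissible triple -/

section Measurements
variable {n : Type*} [Fintype n] [DecidableEq n]

theorem EigenDecomposition.krausComplete_krausII {X : Matrix n n ℂ} {ι : Type*} [Fintype ι]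
    (d : EigenDecomposition X ι) : KrausComplete (krausII d.proj) := by
  simp only [KrausComplete, krausII, (d.proj_isHermitian _).eq, d.proj_mul_self, d.sum_proj]

theorem EigenDecomposition.krausComplete_krausI {F : Matrix n n ℂ} {J φ : Type*} [Fintype J]
    [Fintype φ] (d : EigenDecomposition F φ) {K : J → Matrix n n ℂ} (hK : KrausComplete K) :
    KrausComplete (krausI d.proj K) := by
  have h : ∀ j f, (d.proj f * K j)ᴴ * (d.proj f * K j) = (K j)ᴴ * d.proj f * K j := by
    intro j f
    rw [Matrix.conjTranspose_mul, (d.proj_isHermitian f).eq,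
      show (K j)ᴴ * d.proj f * (d.proj f * K j) = (K j)ᴴ * (d.proj f * d.proj f) * K j by
        simp only [Matrix.mul_assoc], d.proj_mul_self]
  simp only [KrausComplete, krausI, Fintype.sum_prod_type, h]
  simp only [← Finset.sum_mul, ← Finset.mul_sum, d.sum_proj, mul_one]
  exact hK

variable {J : Type*} [Fintype J]

/-- The neighbourhood filter contains `t = 0`, where the `O` bounds become equalities. If every `p
j` vanished, so would every `K j 0`, contradicting completeness. -/
theorem IsWeakMeasurement.exists_prob_pos [Nonempty n] {A : Matrix n n ℂ} {p : J → ℝ}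
    {g : J → ℝ → ℂ} {K : J → ℝ → Matrix n n ℂ} (hK : IsWeakMeasurement A p g K) :
    ∃ j, 0 < p j := by
  by_contra! hp
  have hK0 : ∀ j, K j 0 = 0 := by
    intro j
    have hp0 : p j = 0 := le_antisymm (hp j) (hK.prob_nonneg j)
    have hg : g j 0 = 0 := (hK.coupling j).eq_zero_imp.self_of_nhds rfl
    ext a b
    have h := (hK.expansion j a b).eq_zero_imp.self_of_nhds (zero_pow two_ne_zero)
    simpa [hp0, hg] using h
  have h := hK.complete.self_of_nhds
  simp [KrausComplete, hK0] at h

/-- These traces add up to the dimension, which is positive. -/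
theorem exists_trace_proj_mul_proj_ne_zero [Nonempty n] {X F : Matrix n n ℂ} {ι φ : Type*}
    [Fintype ι] [Fintype φ] (dI : EigenDecomposition X ι) (dF : EigenDecomposition F φ) :
    ∃ i f, (dF.proj f * dI.proj i).trace.re ≠ 0 := by
  by_contra! h
  have h1 : ∑ f, ∑ i, (dF.proj f * dI.proj i).trace = (1 : Matrix n n ℂ).trace := by
    simp only [← Matrix.trace_sum, ← Finset.mul_sum, dI.sum_proj, mul_one, dF.sum_proj]
  have h2 := congrArg Complex.re h1
  rw [Complex.re_sum] at h2
  simp only [Complex.re_sum, h, Finset.sum_const_zero, Matrix.trace_one, Complex.natCast_re] at h2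
  exact Fintype.card_ne_zero (Nat.cast_eq_zero.1 h2.symm)

end Measurements

/-! ### The weak-value bound -/

theorem theorem2 {n J ι φ : Type*} [Fintype n] [DecidableEq n] [Fintype J] [DecidableEq J]
    [Fintype ι] [DecidableEq ι] [Fintype φ] [DecidableEq φ]
    (A F I : Matrix n n ℂ) (hA : A.IsHermitian)
    (dI : EigenDecomposition I ι) (dF : EigenDecomposition F φ)
    (p : J → ℝ) (g : J → ℝ → ℂ) (K : J → ℝ → Matrix n n ℂ)
    (hK : IsWeakMeasurement A p g K) :
    ∃ R : ι → J → φ → ℝ → ℝ,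
      (∀ i j f, R i j f =O[𝓝 0] fun t : ℝ => t ^ 2) ∧
      ∀ᶠ t in 𝓝 (0 : ℝ), ∀ ρ : Matrix n n ℂ, IsDensity ρ →
        (vonNeumannEntropy (registerState (krausII dI.proj) ρ)
            + vonNeumannEntropy (registerState (krausI dF.proj fun j => K j t) ρ)
          ≥ fWeak A dI.proj dF.proj p (fun j => g j t) (fun i j f => R i j f t)) ∧
        (∀ α β : ℝ≥0∞, α⁻¹ + β⁻¹ = 2 →
          renyiEntropy α (registerState (krausII dI.proj) ρ)
            + renyiEntropy β (registerState (krausI dF.proj fun j => K j t) ρ)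
          ≥ fWeak A dI.proj dF.proj p (fun j => g j t) (fun i j f => R i j f t)) := by
  rcases isEmpty_or_nonempty n with hn | hn
  · refine ⟨fun _ _ _ _ => 0, fun _ _ _ => isBigO_zero _ _, Eventually.of_forall fun t ρ hρ => ?_⟩
    have h := hρ.2
    simp [Matrix.trace] at h
  let c : ι → J → φ → ℝ → ℝ := fun i j f t => overlap (dF.proj f) (K j t) (dI.proj i)
  let q : ι → J → φ → ℝ := fun i j f => p j * (dF.proj f * dI.proj i).trace.re
  have hq0 : ∀ i j f, 0 ≤ q i j f := fun i j f => by
    refine mul_nonneg (hK.prob_nonneg j) ?_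
    rw [trace_mul_proj_eq (dF.proj_isHermitian f) (dF.proj_mul_self f) (dI.proj_isHermitian i)
      (dI.proj_mul_self i), Complex.ofReal_re]
    positivity
  let L : ι → J → φ → ℝ → ℝ := fun i j f t =>
    2 * Real.sqrt (p j) * (g j t * (dF.proj f * A * dI.proj i).trace).re
  have hL : ∀ i j f, L i j f =O[𝓝 0] fun t : ℝ => t := fun i j f => by
    have h := (hK.coupling j).mul (isBigO_const_const (dF.proj f * A * dI.proj i).trace
      (one_ne_zero (α := ℝ)) (𝓝 (0 : ℝ)))
    simp only [mul_one] at h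
    exact ((IsBigO.of_norm_le fun t => Complex.abs_re_le_norm _).trans h.norm_left).const_mul_left _
  have hc : ∀ i j f, (fun t => c i j f t - (q i j f + L i j f t)) =O[𝓝 0] fun t : ℝ => t ^ 2 :=
    fun i j f => isBigO_overlap_sub hA (dF.proj_isHermitian f) (dF.proj_mul_self f)
      (dI.proj_isHermitian i) (dI.proj_mul_self i) (hK.prob_nonneg j) (hK.coupling j)
      (hK.expansion j)
  have hclim : ∀ i j f, Tendsto (c i j f) (𝓝 0) (𝓝 (q i j f)) := fun i j f => by
    have h2 : Tendsto (fun t : ℝ => t ^ 2) (𝓝 0) (𝓝 0) := by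
      simpa using (continuous_pow 2).tendsto (0 : ℝ)
    have h := ((hc i j f).trans_tendsto h2).add
      (((hL i j f).trans_tendsto tendsto_id).const_add (q i j f))
    simpa using h
  obtain ⟨j₀, hj₀⟩ := hK.exists_prob_pos
  obtain ⟨i₀, f₀, hif₀⟩ := exists_trace_proj_mul_proj_ne_zero dI dF
  have hx₀ : q i₀ j₀ f₀ ≠ 0 := mul_ne_zero hj₀.ne' hif₀
  classical
  -- The remainder is the exact error, so each admissible bracket equals `-log c`. Its value at
  -- triples outside the minimum is irrelevant and set to `0`.
  refine ⟨fun i j f t => if q i j f = 0 then 0 else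
    -Real.logb 2 (c i j f t) - weakBoundTerm A (dI.proj i) (dF.proj f) (p j) (g j t), ?_, ?_⟩
  · intro i j f
    by_cases hq : q i j f = 0
    · simp only [hq, if_true]
      exact isBigO_zero _ _
    · simp only [hq, if_false]
      have hp : 0 < p j := (hK.prob_nonneg j).lt_of_ne' (left_ne_zero_of_mul hq)
      refine (isBigO_logb_sub ((hq0 i j f).lt_of_ne' hq) (hL i j f) (hc i j f)).neg_left.congr_left
        fun t => ?_
      rw [weakBoundTerm_eq (dF.proj_isHermitian f) (dF.proj_mul_self f) (dI.proj_isHermitian i)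
        (dI.proj_mul_self i) (dI.proj_ne_zero i) hp (right_ne_zero_of_mul hq)]
      simp only [q, L]
      ring
  -- An excluded overlap tends to `0`, while the reference overlap has a positive limit and so
  -- eventually dominates it.
  have hsmall : ∀ i j f, ∀ᶠ t in 𝓝 (0 : ℝ), q i j f = 0 → c i j f t ≤ c i₀ j₀ f₀ t := by
    intro i j f
    by_cases hq : q i j f = 0
    · have h := (hclim i j f).eventually_lt (hclim i₀ j₀ f₀)
        (by rw [hq]; exact (hq0 _ _ _).lt_of_ne' hx₀)
      filter_upwards [h] with t ht _ using ht.le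
    · exact Eventually.of_forall fun t h => absurd h hq
  have hpos := (hclim i₀ j₀ f₀).eventually (lt_mem_nhds ((hq0 i₀ j₀ f₀).lt_of_ne' hx₀))
  filter_upwards [hK.complete, hpos, eventually_all.2 fun i => eventually_all.2 fun j =>
    eventually_all.2 fun f => hsmall i j f] with t hcomp hpos hsmall
  have : Nonempty {x : ι × J × φ // p x.2.1 * (dF.proj x.2.2 * dI.proj x.1).trace.re ≠ 0} :=
    ⟨⟨(i₀, j₀, f₀), hx₀⟩⟩
  -- The largest admissible overlap serves as `c`, and the minimum in `fWeak` is at most its value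
  -- at this triple.
  obtain ⟨z, hz⟩ := Finite.exists_max
    fun x : {x : ι × J × φ // p x.2.1 * (dF.proj x.2.2 * dI.proj x.1).trace.re ≠ 0} =>
      c x.1.1 x.1.2.1 x.1.2.2 t
  have hz₀ := hz ⟨(i₀, j₀, f₀), hx₀⟩
  have hmax : ∀ i (x : J × φ), c i x.1 x.2 t ≤ c z.1.1 z.1.2.1 z.1.2.2 t := by
    intro i x
    by_cases hq : q i x.1 x.2 = 0
    · exact (hsmall i x.1 x.2 hq).trans hz₀
    · exact hz ⟨(i, x.1, x.2), hq⟩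
  have hcz := hpos.trans_le hz₀
  have hf : fWeak A dI.proj dF.proj p (fun j => g j t) (fun i j f => if q i j f = 0 then 0 else
      -Real.logb 2 (c i j f t) - weakBoundTerm A (dI.proj i) (dF.proj f) (p j) (g j t))
      ≤ -Real.logb 2 (c z.1.1 z.1.2.1 z.1.2.2 t) := by
    refine (ciInf_le (Set.finite_range _).bddBelow z).trans_eq ?_
    simp only [if_neg (show q z.1.1 z.1.2.1 z.1.2.2 ≠ 0 from z.2)]
    ring
  intro ρ hρ
  have hI := dI.krausComplete_krausII
  have hIF := dF.krausComplete_krausI hcomp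
  exact ⟨hf.trans (vonNeumannEntropy_add_ge hI hIF hcz hmax hρ),
    fun α β hαβ => hf.trans (renyiEntropy_add_ge hI hIF hcz hmax hρ hαβ)⟩
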